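/- For an integer $n\ge 0$ let $\mathrm{inv}_2(n)$ denote the number of inversions in the binary representation of $n$, i.e. the number of occurrences of $10$ as a scattered (not necessarily contiguous) subsequence of the binary representation of $n$ written with its most significant digit first, and let $i_n=(-1)^{\mathrm{inv}_2(n)}$. A finite word is contained in the sequence $(i_n)_{n\ge 0}$ if it is a block $i_m i_{m+1}\cdots i_{m+\ell-1}$ of consecutive terms. For a word $x$, let $|x|$ denote its length and let $x^k$ denote $x$ repeated $k$ times. **Theorem.** The sequence $(i_n)_{n\ge 0}$ has the following properties. 1. It contains no $5$-th powers: there is no non-empty word $x$ such that $x^5$ is contained in $(i_n)_{n\ge0}$. 2. It contains cubes $x^3$ exactly when $|x|=3$: for every integer $L\ge 0$, there is a non-empty word $x$ with $|x|=L$ such that $x^3$ is contained in $(i_n)_{n\ge0}$ if and only if $L=3$. 3. It contains squares $xx$ exactly when $|x|\in\{1,2\}\cup\{3\cdot 2^k : k\ge 0\}$: for every integer $L\ge 0$, there is a non-empty word $x$ with $|x|=L$ such that $xx$ is contained in $(i_n)_{n\ge0}$ if and only if $L\in\{1,2\}\cup\{3\cdot 2^k : k\ge 0\}$. 4. It contains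 arbitrarily long palindromes: for every integer $N\ge0$, there is a word $w$ with $|w|\ge N$ that equals its own reversal and is contained in $(i_n)_{n\ge0}$. -/

import Mathlib

/-- The number of occurrences of the word `p` as a scattered subsequence of the word `w`.
`List.sublists w` lists the subsequences of `w` with multiplicity, one entry for each set of
positions, so counting `p` in it counts the sets of positions at which `p` is read. -/
def scatteredCount (p w : List ℕ) : ℕ :=
  w.sublists.count p

/-- The base-`2` representation of `n`, most significant digit first. The integer `0` is
represented by the empty word. -/
def binaryWord (n : ℕ) : List ℕ :=
  (Nat.digits 2 n).reverse

/-- The number of inversions, that is, of occurrences of `10` as a scattered subsequence, in the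
binary representation of `n`. -/
def inv2 (n : ℕ) : ℕ :=
  scatteredCount [1, 0] (binaryWord n)

/-- The sequence `i_n = (-1) ^ inv2 n`. -/
def iSeq (n : ℕ) : ℤ :=
  (-1) ^ inv2 n

/-- The finite word `w` occurs in (is a block of consecutive terms of) the sequence `u`. -/
def Contains {α : Type*} (u : ℕ → α) (w : List α) : Prop :=
  ∃ m : ℕ, w = (List.range w.length).map (fun j => u (m + j))

/-- The word `x ^ k = x x ⋯ x` (`x` repeated `k` times). -/
def wordPow {α : Type*} (x : List α) (k : ℕ) : List α :=
  (List.replicate k x).flatten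

/-!
The proof rests on the Thue–Morse signs `t n = (-1) ^ (number of ones of n)`. Appending a binary
digit gives `i (2n) = i n * t n` and `i (2n+1) = i n`, so the block of `i` at `4n, …, 4n+3` is
`a, at, -at, a` with `a = i n` and `t = t n`. Hence the sign change `d n = i n * i (n+1)` satisfies
`d (4n) = t n`, `d (4n+1) = -1`, `d (4n+2) = -t n`, `d (4n+3) = d n`, and by induction `d n = 1`
exactly when `t n = 1` and `t (n+1) = -1` (`signChange_eq_one_iff`): `d` is a function of the
Thue–Morse sequence.

A square of odd length `L ≥ 5` makes `d` periodic with period `L` on `L - 1` places. Since the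
places of `d` congruent to `1` modulo `4` carry `-1`, comparing residues fixes the value of `t` at
all `n` in an interval. For `L ≥ 13` this interval has three elements, but `t` has no three equal
consecutive terms; the lengths `5`, `7`, `9`, `11` are excluded by combining all four residues with
`signChange_eq_one_iff`. A power of even length `2L` yields a
power of length `L` with the same exponent by reading the odd places. As no square has length `4`,
the lengths of squares are confined to `1`, `2`, `3 * 2 ^ k`; as no cube has length `1`, `2` or `6`,
cubes have length `3`, and a fifth power of length `3` is excluded directly.

Conversely, `(i, t)` has a common square of length `3` at position `11`, and the recursions double
common squares. Finally the prefix of `i` of length `2 ^ (2k+1)` is a palindrome, by induction on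
`k`: complementing the digits maps `4n + r` to `4n' + (3 - r)`, the block of `i` at `n` is reversed
when `t n` changes sign, and complementing an odd number of digits changes the sign of `t`.
-/

/-! ### Recursions in the binary digits -/

/-- The Thue–Morse sequence with values `±1`: the parity sign of the number of ones in the binary
representation. -/
def thueMorse (n : ℕ) : ℤ :=
  (-1) ^ scatteredCount [1] (binaryWord n)

theorem List.count_concat_map_concat {α : Type*} [DecidableEq α] (p : List α) (a b : α)
    (l : List (List α)) :
    (l.map (fun x => x ++ [b])).count (p ++ [a]) = if a = b then l.count p else 0 := by
  induction l with
  | nil => simp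
  | cons x l ih =>
    rw [List.map_cons, List.count_cons, ih, List.count_cons]
    by_cases h : a = b
    · subst h; simp
    · simp [h, Ne.symm h]

theorem scatteredCount_concat (p w : List ℕ) (a b : ℕ) :
    scatteredCount (p ++ [a]) (w ++ [b]) =
      scatteredCount (p ++ [a]) w + if a = b then scatteredCount p w else 0 := by
  unfold scatteredCount
  rw [List.sublists_concat, List.count_append, List.count_concat_map_concat]

theorem scatteredCount_nil (w : List ℕ) : scatteredCount [] w = 1 := by
  induction w using List.reverseRecOn with
  | nil => simp [scatteredCount]
  | append_singleton w b ih =>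
    unfold scatteredCount at *
    rw [List.sublists_concat, List.count_append, ih, List.count_eq_zero_of_not_mem]
    simp

theorem binaryWord_two_mul_add_one (n : ℕ) : binaryWord (2 * n + 1) = binaryWord n ++ [1] := by
  have := Nat.digits_add 2 (by norm_num) 1 n (by norm_num) (Or.inl one_ne_zero)
  rw [add_comm] at this
  unfold binaryWord
  rw [this, List.reverse_cons]

theorem binaryWord_two_mul {n : ℕ} (hn : n ≠ 0) : binaryWord (2 * n) = binaryWord n ++ [0] := by
  have := Nat.digits_add 2 (by norm_num) 0 n (by norm_num) (Or.inr hn)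
  rw [zero_add] at this
  simp [binaryWord, this]

theorem thueMorse_zero : thueMorse 0 = 1 := by simp [thueMorse, binaryWord, scatteredCount]

theorem thueMorse_two_mul (n : ℕ) : thueMorse (2 * n) = thueMorse n := by
  rcases eq_or_ne n 0 with rfl | hn
  · rfl
  · have := scatteredCount_concat [] (binaryWord n) 1 0
    simp only [List.nil_append] at this
    simp [thueMorse, binaryWord_two_mul hn, this]

theorem thueMorse_two_mul_add_one (n : ℕ) : thueMorse (2 * n + 1) = -thueMorse n := by
  have := scatteredCount_concat [] (binaryWord n) 1 1
  simp only [List.nil_append] at this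
  simp [thueMorse, binaryWord_two_mul_add_one, this, scatteredCount_nil, pow_succ]

theorem iSeq_two_mul (n : ℕ) : iSeq (2 * n) = iSeq n * thueMorse n := by
  rcases eq_or_ne n 0 with rfl | hn
  · simp [thueMorse_zero]
  · have := scatteredCount_concat [1] (binaryWord n) 0 0
    simp only [List.cons_append, List.nil_append] at this
    simp [iSeq, inv2, thueMorse, binaryWord_two_mul hn, this, pow_add]

theorem iSeq_two_mul_add_one (n : ℕ) : iSeq (2 * n + 1) = iSeq n := by
  have := scatteredCount_concat [1] (binaryWord n) 0 1
  simp only [List.cons_append, List.nil_append] at this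
  simp [iSeq, inv2, binaryWord_two_mul_add_one, this]

theorem thueMorse_eq_or (n : ℕ) : thueMorse n = 1 ∨ thueMorse n = -1 :=
  neg_one_pow_eq_or ℤ _

theorem iSeq_eq_or (n : ℕ) : iSeq n = 1 ∨ iSeq n = -1 :=
  neg_one_pow_eq_or ℤ _

theorem thueMorse_four_mul (n : ℕ) : thueMorse (4 * n) = thueMorse n := by
  rw [show 4 * n = 2 * (2 * n) by ring, thueMorse_two_mul, thueMorse_two_mul]

theorem thueMorse_four_mul_add_one (n : ℕ) : thueMorse (4 * n + 1) = -thueMorse n := by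
  rw [show 4 * n + 1 = 2 * (2 * n) + 1 by ring, thueMorse_two_mul_add_one, thueMorse_two_mul]

theorem thueMorse_four_mul_add_two (n : ℕ) : thueMorse (4 * n + 2) = -thueMorse n := by
  rw [show 4 * n + 2 = 2 * (2 * n + 1) by ring, thueMorse_two_mul, thueMorse_two_mul_add_one]

theorem thueMorse_four_mul_add_three (n : ℕ) : thueMorse (4 * n + 3) = thueMorse n := by
  rw [show 4 * n + 3 = 2 * (2 * n + 1) + 1 by ring, thueMorse_two_mul_add_one,
    thueMorse_two_mul_add_one, neg_neg]

theorem iSeq_four_mul (n : ℕ) : iSeq (4 * n) = iSeq n := by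
  rw [show 4 * n = 2 * (2 * n) by ring, iSeq_two_mul, iSeq_two_mul, thueMorse_two_mul]
  rcases thueMorse_eq_or n with h | h <;> simp [h]

theorem iSeq_four_mul_add_one (n : ℕ) : iSeq (4 * n + 1) = iSeq n * thueMorse n := by
  rw [show 4 * n + 1 = 2 * (2 * n) + 1 by ring, iSeq_two_mul_add_one, iSeq_two_mul]

theorem iSeq_four_mul_add_two (n : ℕ) : iSeq (4 * n + 2) = -(iSeq n * thueMorse n) := by
  rw [show 4 * n + 2 = 2 * (2 * n + 1) by ring, iSeq_two_mul, iSeq_two_mul_add_one,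
    thueMorse_two_mul_add_one, mul_neg]

theorem iSeq_four_mul_add_three (n : ℕ) : iSeq (4 * n + 3) = iSeq n := by
  rw [show 4 * n + 3 = 2 * (2 * n + 1) + 1 by ring, iSeq_two_mul_add_one, iSeq_two_mul_add_one]

theorem thueMorse_no_three_equal (n : ℕ) (h₁ : thueMorse n = thueMorse (n + 1))
    (h₂ : thueMorse (n + 1) = thueMorse (n + 2)) : False := by
  obtain ⟨k, rfl | rfl⟩ := Nat.even_or_odd' n
  · rw [thueMorse_two_mul, thueMorse_two_mul_add_one] at h₁
    rcases thueMorse_eq_or k with h | h <;> simp [h] at h₁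
  · rw [show 2 * k + 1 + 1 = 2 * (k + 1) by ring, show 2 * k + 1 + 2 = 2 * (k + 1) + 1 by ring,
      thueMorse_two_mul, thueMorse_two_mul_add_one] at h₂
    rcases thueMorse_eq_or (k + 1) with h | h <;> simp [h] at h₂

/-! ### Sign changes -/

/-- The product of two consecutive terms of `iSeq`: it is `1` when they agree and `-1` when the
sign changes. -/
def signChange (n : ℕ) : ℤ :=
  iSeq n * iSeq (n + 1)

theorem signChange_eq_or (n : ℕ) : signChange n = 1 ∨ signChange n = -1 := by
  unfold signChange
  rcases iSeq_eq_or n with h | h <;> rcases iSeq_eq_or (n + 1) with h' | h' <;> simp [h, h']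

theorem signChange_four_mul (n : ℕ) : signChange (4 * n) = thueMorse n := by
  rw [signChange, iSeq_four_mul, iSeq_four_mul_add_one]
  rcases iSeq_eq_or n with h | h <;> simp [h]

theorem signChange_four_mul_add_one (n : ℕ) : signChange (4 * n + 1) = -1 := by
  rw [signChange, iSeq_four_mul_add_one, iSeq_four_mul_add_two]
  rcases iSeq_eq_or n with h | h <;> rcases thueMorse_eq_or n with h' | h' <;> simp [h, h']

theorem signChange_four_mul_add_two (n : ℕ) : signChange (4 * n + 2) = -thueMorse n := by
  rw [signChange, iSeq_four_mul_add_two, iSeq_four_mul_add_three]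
  rcases iSeq_eq_or n with h | h <;> simp [h]

theorem signChange_four_mul_add_three (n : ℕ) : signChange (4 * n + 3) = signChange n := by
  rw [signChange, iSeq_four_mul_add_three, show 4 * n + 3 + 1 = 4 * (n + 1) by ring,
    iSeq_four_mul, signChange]

theorem Nat.exists_eq_four_mul_add (n : ℕ) :
    ∃ k, n = 4 * k ∨ n = 4 * k + 1 ∨ n = 4 * k + 2 ∨ n = 4 * k + 3 :=
  ⟨n / 4, by omega⟩

/-- Two consecutive terms of `iSeq` agree exactly where the Thue–Morse sequence passes from `1`
to `-1`. -/
theorem signChange_eq_one_iff (n : ℕ) :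
    signChange n = 1 ↔ thueMorse n = 1 ∧ thueMorse (n + 1) = -1 := by
  induction n using Nat.strong_induction_on with
  | _ n ih =>
    obtain ⟨k, rfl | rfl | rfl | rfl⟩ := n.exists_eq_four_mul_add
    · rw [signChange_four_mul, thueMorse_four_mul, thueMorse_four_mul_add_one]
      simp
    · rw [signChange_four_mul_add_one, thueMorse_four_mul_add_one, thueMorse_four_mul_add_two]
      omega
    · rw [signChange_four_mul_add_two, thueMorse_four_mul_add_two, thueMorse_four_mul_add_three]
      omega
    · rw [signChange_four_mul_add_three, thueMorse_four_mul_add_three,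
        show 4 * k + 3 + 1 = 4 * (k + 1) by ring, thueMorse_four_mul, ih k (by omega)]

theorem not_signChange_eq_one_twice {n : ℕ} (h₁ : signChange n = 1)
    (h₂ : signChange (n + 1) = 1) : False := by
  have := ((signChange_eq_one_iff n).1 h₁).2
  have := ((signChange_eq_one_iff (n + 1)).1 h₂).1
  omega

theorem signChange_eq_one_of_iSeq_eq {n : ℕ} (h : iSeq n = iSeq (n + 1)) : signChange n = 1 := by
  rcases iSeq_eq_or (n + 1) with h' | h' <;> simp [signChange, h, h']

theorem signChange_succ_of_iSeq_eq {n : ℕ} (h : iSeq n = iSeq (n + 2)) :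
    signChange n = signChange (n + 1) := by
  rw [signChange, signChange, h, mul_comm]

/-! ### Powers as local periods -/

/-- The sequence `u` has period `p` from position `m` on, as far as the `ℓ` comparisons
`u (m + j) = u (m + j + p)` with `j < ℓ` go; these involve `ℓ + p` consecutive terms. -/
def LocallyPeriodic {α : Type*} (u : ℕ → α) (m ℓ p : ℕ) : Prop :=
  ∀ j < ℓ, u (m + j) = u (m + j + p)

theorem wordPow_length {α : Type*} (x : List α) (k : ℕ) :
    (wordPow x k).length = k * x.length := by
  simp [wordPow]

theorem wordPow_succ {α : Type*} (x : List α) (k : ℕ) : wordPow x (k + 1) = x ++ wordPow x k := by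
  simp [wordPow, List.replicate_succ]

theorem wordPow_succ' {α : Type*} (x : List α) (k : ℕ) :
    wordPow x (k + 1) = wordPow x k ++ x := by
  simp [wordPow, List.replicate_succ']

theorem LocallyPeriodic.wordPow_eq {α : Type*} {u : ℕ → α} {L : ℕ} (k m : ℕ)
    (h : LocallyPeriodic u m (k * L) L) :
    wordPow ((List.range L).map fun j => u (m + j)) (k + 1) =
      (List.range ((k + 1) * L)).map fun j => u (m + j) := by
  induction k with
  | zero => simp [wordPow]
  | succ k ih =>
    rw [wordPow_succ, ih fun j hj => h j (by nlinarith), show (k + 1 + 1) * L = L + (k + 1) * L by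
      ring, List.range_add, List.map_append, List.map_map]
    congr 1
    refine List.map_congr_left fun j hj => ?_
    rw [h j (by simpa using hj)]
    simp only [Function.comp]
    congr 1
    ring

/-- A sequence contains a power of exponent `k + 1` of a word of length `L > 0` exactly when it is
locally periodic with period `L` on `(k + 1) * L` terms, that is, for `k * L` comparisons. -/
theorem exists_contains_wordPow_iff {α : Type*} (u : ℕ → α) (k L : ℕ) :
    (∃ x : List α, x ≠ [] ∧ x.length = L ∧ Contains u (wordPow x (k + 1))) ↔
      0 < L ∧ ∃ m, LocallyPeriodic u m (k * L) L := by
  constructor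
  · rintro ⟨x, hx, rfl, m, hm⟩
    refine ⟨List.length_pos_iff.2 hx, m, fun j hj => ?_⟩
    have hlen : (wordPow x (k + 1)).length = k * x.length + x.length := by
      rw [wordPow_length]; ring
    have key : ∀ p < k * x.length + x.length, (wordPow x (k + 1))[p]? = some (u (m + p)) := by
      intro p hp
      rw [hm, hlen]
      simp [hp]
    have h₁ := key j (by omega)
    have h₂ := key (j + x.length) (by omega)
    rw [wordPow_succ', List.getElem?_append_left (by rwa [wordPow_length])] at h₁
    rw [wordPow_succ, List.getElem?_append_right (by omega), Nat.add_sub_cancel, h₁] at h₂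
    simpa [add_assoc] using h₂
  · rintro ⟨hL, m, h⟩
    refine ⟨(List.range L).map fun j => u (m + j), ?_, by simp, m, ?_⟩
    · rw [← List.length_pos_iff]; simpa
    · rw [wordPow_length, List.length_map, List.length_range]
      exact h.wordPow_eq k m

theorem LocallyPeriodic.mono {α : Type*} {u : ℕ → α} {m ℓ ℓ' p : ℕ}
    (h : LocallyPeriodic u m ℓ p) (hℓ : ℓ' ≤ ℓ) : LocallyPeriodic u m ℓ' p :=
  fun j hj => h j (hj.trans_le hℓ)

theorem LocallyPeriodic.signChange {m ℓ p : ℕ} (h : LocallyPeriodic iSeq m (ℓ + 1) p) {j : ℕ}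
    (h₁ : m ≤ j) (h₂ : j < m + ℓ) : signChange j = signChange (j + p) := by
  obtain ⟨i, rfl⟩ := Nat.exists_eq_add_of_le h₁
  have h₃ := h (i + 1) (by omega)
  rw [← add_assoc] at h₃
  rw [_root_.signChange, _root_.signChange, h i (by omega), h₃, add_right_comm _ 1 p]

/-- Reading the odd places halves a period. -/
theorem LocallyPeriodic.half {m ℓ p : ℕ} (h : LocallyPeriodic iSeq m (2 * ℓ) (2 * p)) :
    LocallyPeriodic iSeq (m / 2) ℓ p := by
  intro j hj
  have := h (2 * (m / 2 + j) + 1 - m) (by omega)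
  rw [show m + (2 * (m / 2 + j) + 1 - m) = 2 * (m / 2 + j) + 1 by omega,
    show 2 * (m / 2 + j) + 1 + 2 * p = 2 * (m / 2 + j + p) + 1 by ring,
    iSeq_two_mul_add_one, iSeq_two_mul_add_one] at this
  exact this

/-- Doubling a period needs it for the pair formed by `iSeq` and `thueMorse`, because
`iSeq (2 * n) = iSeq n * thueMorse n`. -/
theorem LocallyPeriodic.double {m ℓ p : ℕ} (hi : LocallyPeriodic iSeq m ℓ p)
    (ht : LocallyPeriodic thueMorse m ℓ p) :
    LocallyPeriodic iSeq (2 * m) (2 * ℓ) (2 * p) ∧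
      LocallyPeriodic thueMorse (2 * m) (2 * ℓ) (2 * p) := by
  constructor <;> intro j hj <;> obtain ⟨k, rfl | rfl⟩ := Nat.even_or_odd' j
  · rw [show 2 * m + 2 * k + 2 * p = 2 * (m + k + p) by ring,
      show 2 * m + 2 * k = 2 * (m + k) by ring, iSeq_two_mul, iSeq_two_mul,
      hi k (by omega), ht k (by omega)]
  · rw [show 2 * m + (2 * k + 1) + 2 * p = 2 * (m + k + p) + 1 by ring,
      show 2 * m + (2 * k + 1) = 2 * (m + k) + 1 by ring, iSeq_two_mul_add_one,
      iSeq_two_mul_add_one, hi k (by omega)]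
  · rw [show 2 * m + 2 * k + 2 * p = 2 * (m + k + p) by ring,
      show 2 * m + 2 * k = 2 * (m + k) by ring, thueMorse_two_mul, thueMorse_two_mul,
      ht k (by omega)]
  · rw [show 2 * m + (2 * k + 1) + 2 * p = 2 * (m + k + p) + 1 by ring,
      show 2 * m + (2 * k + 1) = 2 * (m + k) + 1 by ring, thueMorse_two_mul_add_one,
      thueMorse_two_mul_add_one, ht k (by omega)]

/-! ### Sign changes under a local period

The next four lemmas compare `signChange (4 * n + r)` with `signChange (4 * n + r + p)`, one lemma
for each residue of the period `p` modulo `4` and one clause for each `r`; for `p` divisible by `4`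
only `r = 0` and `r = 2` are recorded. -/

theorem LocallyPeriodic.period_four_mul {m ℓ q : ℕ}
    (h : LocallyPeriodic iSeq m (ℓ + 1) (4 * q)) (n : ℕ) :
    (m ≤ 4 * n → 4 * n < m + ℓ → thueMorse n = thueMorse (n + q)) ∧
    (m ≤ 4 * n + 2 → 4 * n + 2 < m + ℓ → thueMorse n = thueMorse (n + q)) := by
  refine ⟨fun h₁ h₂ => ?_, fun h₁ h₂ => ?_⟩ <;> have e := h.signChange h₁ h₂
  · rwa [← mul_add, signChange_four_mul, signChange_four_mul] at e
  · rwa [show 4 * n + 2 + 4 * q = 4 * (n + q) + 2 by ring, signChange_four_mul_add_two,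
      signChange_four_mul_add_two, neg_inj] at e

theorem LocallyPeriodic.period_four_mul_add_one {m ℓ q : ℕ}
    (h : LocallyPeriodic iSeq m (ℓ + 1) (4 * q + 1)) (n : ℕ) :
    (m ≤ 4 * n → 4 * n < m + ℓ → thueMorse n = -1) ∧
    (m ≤ 4 * n + 1 → 4 * n + 1 < m + ℓ → thueMorse (n + q) = 1) ∧
    (m ≤ 4 * n + 2 → 4 * n + 2 < m + ℓ → _root_.signChange (n + q) = -thueMorse n) ∧
    (m ≤ 4 * n + 3 → 4 * n + 3 < m + ℓ → _root_.signChange n = thueMorse (n + q + 1)) := by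
  refine ⟨fun h₁ h₂ => ?_, fun h₁ h₂ => ?_, fun h₁ h₂ => ?_, fun h₁ h₂ => ?_⟩ <;>
    have e := h.signChange h₁ h₂
  · rwa [show 4 * n + (4 * q + 1) = 4 * (n + q) + 1 by ring, signChange_four_mul,
      signChange_four_mul_add_one] at e
  · rw [show 4 * n + 1 + (4 * q + 1) = 4 * (n + q) + 2 by ring, signChange_four_mul_add_one,
      signChange_four_mul_add_two] at e
    exact (neg_inj.1 e).symm
  · rw [show 4 * n + 2 + (4 * q + 1) = 4 * (n + q) + 3 by ring, signChange_four_mul_add_two,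
      signChange_four_mul_add_three] at e
    exact e.symm
  · rwa [show 4 * n + 3 + (4 * q + 1) = 4 * (n + q + 1) by ring, signChange_four_mul_add_three,
      signChange_four_mul] at e

theorem LocallyPeriodic.period_four_mul_add_two {m ℓ q : ℕ}
    (h : LocallyPeriodic iSeq m (ℓ + 1) (4 * q + 2)) (n : ℕ) :
    (m ≤ 4 * n → 4 * n < m + ℓ → thueMorse n = -thueMorse (n + q)) ∧
    (m ≤ 4 * n + 1 → 4 * n + 1 < m + ℓ → _root_.signChange (n + q) = -1) ∧
    (m ≤ 4 * n + 2 → 4 * n + 2 < m + ℓ → thueMorse (n + q + 1) = -thueMorse n) ∧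
    (m ≤ 4 * n + 3 → 4 * n + 3 < m + ℓ → _root_.signChange n = -1) := by
  refine ⟨fun h₁ h₂ => ?_, fun h₁ h₂ => ?_, fun h₁ h₂ => ?_, fun h₁ h₂ => ?_⟩ <;>
    have e := h.signChange h₁ h₂
  · rwa [show 4 * n + (4 * q + 2) = 4 * (n + q) + 2 by ring, signChange_four_mul,
      signChange_four_mul_add_two] at e
  · rw [show 4 * n + 1 + (4 * q + 2) = 4 * (n + q) + 3 by ring, signChange_four_mul_add_one,
      signChange_four_mul_add_three] at e
    exact e.symm
  · rw [show 4 * n + 2 + (4 * q + 2) = 4 * (n + q + 1) by ring, signChange_four_mul_add_two,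
      signChange_four_mul] at e
    exact e.symm
  · rwa [show 4 * n + 3 + (4 * q + 2) = 4 * (n + q + 1) + 1 by ring,
      signChange_four_mul_add_three, signChange_four_mul_add_one] at e

theorem LocallyPeriodic.period_four_mul_add_three {m ℓ q : ℕ}
    (h : LocallyPeriodic iSeq m (ℓ + 1) (4 * q + 3)) (n : ℕ) :
    (m ≤ 4 * n → 4 * n < m + ℓ → _root_.signChange (n + q) = thueMorse n) ∧
    (m ≤ 4 * n + 1 → 4 * n + 1 < m + ℓ → thueMorse (n + q + 1) = -1) ∧
    (m ≤ 4 * n + 2 → 4 * n + 2 < m + ℓ → thueMorse n = 1) ∧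
    (m ≤ 4 * n + 3 → 4 * n + 3 < m + ℓ → _root_.signChange n = -thueMorse (n + q + 1)) := by
  refine ⟨fun h₁ h₂ => ?_, fun h₁ h₂ => ?_, fun h₁ h₂ => ?_, fun h₁ h₂ => ?_⟩ <;>
    have e := h.signChange h₁ h₂
  · rw [show 4 * n + (4 * q + 3) = 4 * (n + q) + 3 by ring, signChange_four_mul,
      signChange_four_mul_add_three] at e
    exact e.symm
  · rw [show 4 * n + 1 + (4 * q + 3) = 4 * (n + q + 1) by ring, signChange_four_mul_add_one,
      signChange_four_mul] at e
    exact e.symm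
  · rw [show 4 * n + 2 + (4 * q + 3) = 4 * (n + q + 1) + 1 by ring, signChange_four_mul_add_two,
      signChange_four_mul_add_one] at e
    exact neg_inj.1 e
  · rwa [show 4 * n + 3 + (4 * q + 3) = 4 * (n + q + 1) + 2 by ring,
      signChange_four_mul_add_three, signChange_four_mul_add_two] at e

/-! ### Squares of odd length -/

theorem not_square_odd_large {m L : ℕ} (hL : 13 ≤ L) (hodd : L % 2 = 1)
    (h : LocallyPeriodic iSeq m L L) : False := by
  have h' : LocallyPeriodic iSeq m (12 + 1) L := h.mono hL
  -- Twelve consecutive places contain three of each residue modulo `4`.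
  obtain ⟨q, rfl | rfl⟩ : ∃ q, L = 4 * q + 1 ∨ L = 4 * q + 3 := ⟨L / 4, by omega⟩
  · have h₀ := (h'.period_four_mul_add_one ((m + 3) / 4)).1 (by omega) (by omega)
    have h₁ := (h'.period_four_mul_add_one ((m + 3) / 4 + 1)).1 (by omega) (by omega)
    have h₂ := (h'.period_four_mul_add_one ((m + 3) / 4 + 2)).1 (by omega) (by omega)
    exact thueMorse_no_three_equal _ (h₀.trans h₁.symm) (h₁.trans h₂.symm)
  · have h₀ := (h'.period_four_mul_add_three ((m + 1) / 4)).2.2.1 (by omega) (by omega)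
    have h₁ := (h'.period_four_mul_add_three ((m + 1) / 4 + 1)).2.2.1 (by omega) (by omega)
    have h₂ := (h'.period_four_mul_add_three ((m + 1) / 4 + 2)).2.2.1 (by omega) (by omega)
    exact thueMorse_no_three_equal _ (h₀.trans h₁.symm) (h₁.trans h₂.symm)

theorem not_square_five {m : ℕ} (h : LocallyPeriodic iSeq m 5 5) : False := by
  have A := LocallyPeriodic.period_four_mul_add_one (ℓ := 4) (q := 1) h
  -- The values of `signChange` alone are compatible with a period `5`, so the equality `e` of the
  -- first terms has to be used.
  have e := h 0 (by norm_num)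
  rw [add_zero] at e
  obtain ⟨n, rfl | rfl | rfl | rfl⟩ := m.exists_eq_four_mul_add
  · have h₁ := (A n).1 (by omega) (by omega)
    have h₂ := (A n).2.1 (by omega) (by omega)
    rw [show 4 * n + 5 = 4 * (n + 1) + 1 by ring, iSeq_four_mul, iSeq_four_mul_add_one, h₂,
      mul_one] at e
    have := (signChange_eq_one_iff n).1 (signChange_eq_one_of_iSeq_eq e)
    omega
  · have h₁ := (A n).2.1 (by omega) (by omega)
    have h₂ := (A (n + 1)).1 (by omega) (by omega)
    omega
  · have h₁ := (A n).2.2.2 (by omega) (by omega)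
    rw [(A (n + 1)).2.1 (by omega) (by omega)] at h₁
    rw [show 4 * n + 7 = 4 * (n + 1) + 3 by ring, iSeq_four_mul_add_two, iSeq_four_mul_add_three,
      ((signChange_eq_one_iff n).1 h₁).1, mul_one] at e
    rw [signChange, ← e] at h₁
    rcases iSeq_eq_or n with h' | h' <;> simp [h'] at h₁
  · have h₁ := (A n).2.2.2 (by omega) (by omega)
    rw [(A (n + 1)).2.1 (by omega) (by omega)] at h₁
    rw [show 4 * n + 8 = 4 * (n + 2) by ring, iSeq_four_mul_add_three, iSeq_four_mul] at e
    exact not_signChange_eq_one_twice h₁ (signChange_succ_of_iSeq_eq e ▸ h₁)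

/-- The window starts at `4 * n + r`; in each of the four cases the comparisons at `n`, `n + 1`, …
together with `signChange_eq_one_iff` are inconsistent. The lengths `9` and `11` are excluded in the
same way. -/
theorem not_square_seven {m : ℕ} (h : LocallyPeriodic iSeq m 7 7) : False := by
  have A := LocallyPeriodic.period_four_mul_add_three (ℓ := 6) (q := 1) h
  clear h
  obtain ⟨n, rfl | rfl | rfl | rfl⟩ := m.exists_eq_four_mul_add
  all_goals
    have := A n
    have := A (n + 1)
    have := A (n + 2)
    have := signChange_eq_one_iff n
    have := signChange_eq_one_iff (n + 1)
    have := signChange_eq_one_iff (n + 2)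
    clear A
    simp only [add_assoc, Nat.reduceAdd] at *
    grind

theorem not_square_nine {m : ℕ} (h : LocallyPeriodic iSeq m 9 9) : False := by
  have A := LocallyPeriodic.period_four_mul_add_one (ℓ := 8) (q := 2) h
  clear h
  obtain ⟨n, rfl | rfl | rfl | rfl⟩ := m.exists_eq_four_mul_add
  all_goals
    have := A n
    have := A (n + 1)
    have := A (n + 2)
    have := signChange_eq_one_iff n
    have := signChange_eq_one_iff (n + 1)
    have := signChange_eq_one_iff (n + 2)
    have := signChange_eq_one_iff (n + 3)
    have := signChange_eq_one_iff (n + 4)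
    clear A
    simp only [add_assoc, Nat.reduceAdd] at *
    grind

theorem not_square_eleven {m : ℕ} (h : LocallyPeriodic iSeq m 11 11) : False := by
  have A := LocallyPeriodic.period_four_mul_add_three (ℓ := 10) (q := 2) h
  clear h
  obtain ⟨n, rfl | rfl | rfl | rfl⟩ := m.exists_eq_four_mul_add
  all_goals
    have := A n
    have := A (n + 1)
    have := A (n + 2)
    have := A (n + 3)
    have := signChange_eq_one_iff n
    have := signChange_eq_one_iff (n + 1)
    have := signChange_eq_one_iff (n + 2)
    have := signChange_eq_one_iff (n + 3)
    have := signChange_eq_one_iff (n + 4)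
    have := signChange_eq_one_iff (n + 5)
    clear A
    simp only [add_assoc, Nat.reduceAdd] at *
    grind

/-! ### Powers of even length -/

theorem not_square_four {m : ℕ} (h : LocallyPeriodic iSeq m 4 4) : False := by
  have A := LocallyPeriodic.period_four_mul (ℓ := 3) (q := 1) h
  -- Of the four compared places, one is a multiple of `4` and one precedes a multiple of `4`.
  have e₀ : ∀ k, m ≤ 4 * k → 4 * k < m + 4 → signChange k = 1 := fun k h₁ h₂ => by
    have := h (4 * k - m) (by omega)
    rw [Nat.add_sub_cancel' h₁, ← mul_add_one, iSeq_four_mul, iSeq_four_mul] at this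
    exact signChange_eq_one_of_iSeq_eq this
  have e₃ : ∀ k, m ≤ 4 * k + 3 → 4 * k + 3 < m + 4 → signChange k = 1 := fun k h₁ h₂ => by
    have := h (4 * k + 3 - m) (by omega)
    rw [Nat.add_sub_cancel' h₁, show 4 * k + 3 + 4 = 4 * (k + 1) + 3 by ring,
      iSeq_four_mul_add_three, iSeq_four_mul_add_three] at this
    exact signChange_eq_one_of_iSeq_eq this
  -- In each case `thueMorse` takes equal values at `k` and `k + 1`.
  have key : ∀ k, signChange k = 1 → thueMorse k ≠ thueMorse (k + 1) := fun k hk => by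
    have := (signChange_eq_one_iff k).1 hk
    omega
  obtain ⟨n, rfl | rfl | rfl | rfl⟩ := m.exists_eq_four_mul_add
  · exact key n (e₀ n (by omega) (by omega)) ((A n).1 (by omega) (by omega))
  · exact key n (e₃ n (by omega) (by omega)) ((A n).2 (by omega) (by omega))
  · exact key n (e₃ n (by omega) (by omega)) ((A n).2 (by omega) (by omega))
  · exact key (n + 1) (e₀ _ (by omega) (by omega)) ((A (n + 1)).1 (by omega) (by omega))

/-- The length of a square is `1`, `2` or `3 * 2 ^ k`. -/
theorem square_length {L : ℕ} (hL : 0 < L) {m : ℕ} (h : LocallyPeriodic iSeq m L L) :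
    L = 1 ∨ L = 2 ∨ ∃ k, L = 3 * 2 ^ k := by
  induction L using Nat.strong_induction_on generalizing m with
  | _ L ih =>
    obtain ⟨K, rfl | rfl⟩ := Nat.even_or_odd' L
    · rcases ih K (by omega) (by omega) h.half with rfl | rfl | ⟨k, rfl⟩
      · simp
      · exact (not_square_four h).elim
      · exact Or.inr (Or.inr ⟨k + 1, by ring⟩)
    · by_cases hK : 13 ≤ 2 * K + 1
      · exact (not_square_odd_large hK (by omega) h).elim
      · obtain rfl | rfl | rfl | rfl | rfl | rfl : K = 0 ∨ K = 1 ∨ K = 2 ∨ K = 3 ∨ K = 4 ∨ K = 5 := by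
          omega
        · simp
        · exact Or.inr (Or.inr ⟨0, by norm_num⟩)
        · exact (not_square_five h).elim
        · exact (not_square_seven h).elim
        · exact (not_square_nine h).elim
        · exact (not_square_eleven h).elim

theorem exists_square_three_mul_two_pow (k : ℕ) :
    ∃ m, LocallyPeriodic iSeq m (3 * 2 ^ k) (3 * 2 ^ k) ∧
      LocallyPeriodic thueMorse m (3 * 2 ^ k) (3 * 2 ^ k) := by
  induction k with
  | zero =>
    -- The first place where both sequences have a square of length `3`.
    refine ⟨11, ?_, ?_⟩ <;> unfold LocallyPeriodic <;> decide
  | succ k ih =>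
    obtain ⟨m, hi, ht⟩ := ih
    rw [show 3 * 2 ^ (k + 1) = 2 * (3 * 2 ^ k) by ring]
    exact ⟨2 * m, hi.double ht⟩

/-! ### Cubes and fifth powers -/

theorem not_cube_one {m : ℕ} (h : LocallyPeriodic iSeq m 2 1) : False :=
  not_signChange_eq_one_twice (signChange_eq_one_of_iSeq_eq (h 0 (by norm_num)))
    (signChange_eq_one_of_iSeq_eq (h 1 (by norm_num)))

theorem not_cube_two {m : ℕ} (h : LocallyPeriodic iSeq m 4 2) : False := by
  have e : ∀ j < 4, signChange (m + j) = signChange (m + j + 1) := fun j hj =>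
    signChange_succ_of_iSeq_eq (h j hj)
  have e₀ := e 0 (by norm_num)
  have e₁ := e 1 (by norm_num)
  have e₂ := e 2 (by norm_num)
  have e₃ := e 3 (by norm_num)
  -- All five values of `signChange` agree, and they cannot be `1`.
  have c : signChange m = -1 := (signChange_eq_or m).resolve_left fun c =>
    not_signChange_eq_one_twice c (e₀ ▸ c)
  simp only [add_assoc, add_zero, Nat.reduceAdd] at e₀ e₁ e₂ e₃
  obtain ⟨n, rfl | rfl | rfl | rfl⟩ := m.exists_eq_four_mul_add
  · have := signChange_four_mul n
    have := signChange_four_mul_add_two n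
    omega
  · have := signChange_four_mul_add_two n
    have := signChange_four_mul_add_three n
    have := signChange_four_mul (n + 1)
    have := signChange_eq_one_iff n
    simp only [mul_add, add_assoc, Nat.reduceAdd, mul_one] at *
    omega
  · have := signChange_four_mul (n + 1)
    have := signChange_four_mul_add_two (n + 1)
    simp only [mul_add, add_assoc, Nat.reduceAdd, mul_one] at *
    omega
  · have := signChange_four_mul (n + 1)
    have := signChange_four_mul_add_two (n + 1)
    simp only [mul_add, add_assoc, Nat.reduceAdd, mul_one] at *
    omega

theorem not_cube_six {m : ℕ} (h : LocallyPeriodic iSeq m 12 6) : False := by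
  have A := LocallyPeriodic.period_four_mul_add_two (ℓ := 11) (q := 1) h
  -- `4 * k` is the first multiple of `4` in the window, and `4 * k + 4` belongs to it as well.
  obtain ⟨k, h₁, h₂⟩ : ∃ k, m ≤ 4 * k ∧ 4 * k < m + 4 := ⟨(m + 3) / 4, by omega, by omega⟩
  have e₁ := (A k).1 (by omega) (by omega)
  have e₂ := (A (k + 1)).1 (by omega) (by omega)
  have e₃ := (A k).2.2.1 (by omega) (by omega)
  have := thueMorse_eq_or k
  omega

/-- Every cube has length `3`: among the lengths of squares, `1` and `2` are excluded, and halving a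
cube of length `3 * 2 ^ (k + 1)` repeatedly leads to a cube of length `6`. -/
theorem cube_length {L : ℕ} (hL : 0 < L) {m : ℕ} (h : LocallyPeriodic iSeq m (2 * L) L) :
    L = 3 := by
  rcases square_length hL (h.mono (by omega)) with rfl | rfl | ⟨k, rfl⟩
  · exact (not_cube_one h).elim
  · exact (not_cube_two h).elim
  · clear hL
    cases k with
    | zero => rfl
    | succ k =>
      exfalso
      induction k generalizing m with
      | zero => exact not_cube_six h
      | succ k ih =>
        rw [show 3 * 2 ^ (k + 1 + 1) = 2 * (3 * 2 ^ (k + 1)) by ring] at h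
        exact ih h.half

theorem not_fifth_power_three {m : ℕ} (h : LocallyPeriodic iSeq m 12 3) : False := by
  have A := LocallyPeriodic.period_four_mul_add_three (ℓ := 11) (q := 0) h
  -- The places `4 * k + 1` and `4 * k + 6` of the window give `thueMorse (k + 1)` opposite values.
  obtain ⟨k, h₁, h₂⟩ : ∃ k, m ≤ 4 * k + 1 ∧ 4 * k + 1 < m + 4 :=
    ⟨(m + 2) / 4, by omega, by omega⟩
  have e₁ := (A k).2.1 (by omega) (by omega)
  have e₂ := (A (k + 1)).2.2.1 (by omega) (by omega)
  rw [add_zero] at e₁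
  omega

/-! ### Palindromic prefixes -/

/-- Writing `n' = 2 ^ (2k+1) - 1 - n` for the complement of an odd number of binary digits, one has
`i n' = i n` and `t n' = -t n`. -/
theorem iSeq_complement (k : ℕ) {n n' : ℕ} (h : n + n' + 1 = 2 ^ (2 * k + 1)) :
    iSeq n' = iSeq n ∧ thueMorse n' = -thueMorse n := by
  induction k generalizing n n' with
  | zero =>
    have h₀ := iSeq_two_mul_add_one 0
    have h₁ := thueMorse_two_mul_add_one 0
    norm_num at h₀ h₁ h
    obtain ⟨rfl, rfl⟩ | ⟨rfl, rfl⟩ : n = 0 ∧ n' = 1 ∨ n = 1 ∧ n' = 0 := by omega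
    · exact ⟨h₀, h₁⟩
    · exact ⟨h₀.symm, by rw [h₁, neg_neg]⟩
  | succ k ih =>
    rw [show 2 * (k + 1) + 1 = 2 * k + 1 + 2 by ring, pow_add] at h
    obtain ⟨b, hb⟩ := n'.exists_eq_four_mul_add
    obtain ⟨a, ha⟩ := n.exists_eq_four_mul_add
    obtain ⟨hi, ht⟩ := @ih a b (by omega)
    obtain ⟨rfl, rfl⟩ | ⟨rfl, rfl⟩ | ⟨rfl, rfl⟩ | ⟨rfl, rfl⟩ :
        (n = 4 * a ∧ n' = 4 * b + 3) ∨ (n = 4 * a + 1 ∧ n' = 4 * b + 2) ∨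
        (n = 4 * a + 2 ∧ n' = 4 * b + 1) ∨ (n = 4 * a + 3 ∧ n' = 4 * b) := by omega
    all_goals
      simp only [iSeq_four_mul, iSeq_four_mul_add_one, iSeq_four_mul_add_two,
        iSeq_four_mul_add_three, thueMorse_four_mul, thueMorse_four_mul_add_one,
        thueMorse_four_mul_add_two, thueMorse_four_mul_add_three, hi, ht]
      simp

theorem exists_palindrome (N : ℕ) :
    ∃ w : List ℤ, N ≤ w.length ∧ w.reverse = w ∧ Contains iSeq w := by
  refine ⟨(List.range (2 ^ (2 * N + 1))).map iSeq, ?_, ?_, 0, by simp⟩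
  · have : 2 * N + 1 < 2 ^ (2 * N + 1) := Nat.lt_two_pow_self
    simp only [List.length_map, List.length_range]
    omega
  · refine List.ext_getElem (by simp) fun j h₁ h₂ => ?_
    simp only [List.length_map, List.length_range] at h₂
    simp only [List.getElem_reverse, List.getElem_map, List.getElem_range, List.length_map,
      List.length_range]
    exact (iSeq_complement N (by omega)).1

/-! ### Lengths of powers and palindromes -/

theorem mainTheorem3 :
    (¬ ∃ x : List ℤ, x ≠ [] ∧ Contains iSeq (wordPow x 5)) ∧
    (∀ L : ℕ, (∃ x : List ℤ, x ≠ [] ∧ x.length = L ∧ Contains iSeq (wordPow x 3)) ↔ L = 3) ∧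
    (∀ L : ℕ, (∃ x : List ℤ, x ≠ [] ∧ x.length = L ∧ Contains iSeq (wordPow x 2)) ↔
      L ∈ ({1, 2} ∪ {m : ℕ | ∃ k : ℕ, m = 3 * 2 ^ k} : Set ℕ)) ∧
    (∀ N : ℕ, ∃ w : List ℤ, N ≤ w.length ∧ w.reverse = w ∧ Contains iSeq w) := by
  refine ⟨?_, fun L => ?_, fun L => ?_, exists_palindrome⟩
  · rintro ⟨x, hx, hc⟩
    obtain ⟨hL, m, h⟩ := (exists_contains_wordPow_iff iSeq 4 x.length).1 ⟨x, hx, rfl, hc⟩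
    have h3 := cube_length hL (h.mono (by omega))
    rw [h3] at h
    exact not_fifth_power_three h
  · rw [exists_contains_wordPow_iff iSeq 2 L]
    constructor
    · rintro ⟨hL, m, h⟩
      exact cube_length hL h
    · rintro rfl
      exact ⟨by norm_num, 0, by unfold LocallyPeriodic; decide⟩
  · rw [exists_contains_wordPow_iff iSeq 1 L]
    simp only [one_mul, Set.mem_union, Set.mem_insert_iff, Set.mem_singleton_iff,
      Set.mem_ofPred_eq, or_assoc]
    constructor
    · rintro ⟨hL, m, h⟩
      exact square_length hL h
    · rintro (rfl | rfl | ⟨k, rfl⟩)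
      · exact ⟨by norm_num, 0, by unfold LocallyPeriodic; decide⟩
      · exact ⟨by norm_num, 7, by unfold LocallyPeriodic; decide⟩
      · obtain ⟨m, hm, -⟩ := exists_square_three_mul_two_pow k
        exact ⟨by positivity, m, hm⟩
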